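/- Let $\mathscr A$ be a (not necessarily unital) $C^*$-algebra and let $\mathscr X$ be a Hilbert $\mathscr A$-module, that is, a complex vector space and right $\mathscr A$-module with $\mu(xa)=(\mu x)a=x(\mu a)$, equipped with an $\mathscr A$-valued inner product $\langle\cdot,\cdot\rangle$ that is $\mathbb C$-linear in the second variable and satisfies $\langle x,ya\rangle=\langle x,y\rangle a$, $\langle x,y\rangle^*=\langle y,x\rangle$, $\langle x,x\rangle\ge 0$, and $\langle x,x\rangle=0$ if and only if $x=0$, such that $\mathscr X$ is complete with respect to the norm $\|x\|=\|\langle x,x\rangle\|^{1/2}$. Let $\mathbb T=\{\lambda\in\mathbb C:|\lambda|=1\}$. For elements $u,v$ of a complex normed space write $u\parallel v$ if $\|u+\lambda v\|=\|u\|+\|v\|$ for some $\lambda\in\mathbb T$. For $a\in\mathscr A$ let $r(a)$ be the spectral radius of $a$ (computed in the unitization of $\mathscr A$ if $\mathscr A$ has no unit). Then for all $x,y\in\mathscr X$ the following statements are mutually equivalent: (i) $x\parallel y$; (ii) $\langle x,x\rangle\parallel\langle x,y\rangle$ and $\|\langle x,y\rangle\|=\|x\|\,\|y\|$; (iii) $r(\langle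 x,y\rangle)=\|\langle x,y\rangle\|=\|x\|\,\|y\|$; (iv) $\|\langle x,x+\lambda y\rangle\|=\|x\|\,(\|x\|+\|y\|)$ for some $\lambda\in\mathbb T$. -/

import Mathlib

open scoped RightActions ENNReal

/-- Two vectors of a complex normed space are *parallel* if `‖x + z y‖ = ‖x‖ + ‖y‖` for some
complex number `z` of modulus one. -/
def Parallel {V : Type*} [NormedAddCommGroup V] [NormedSpace ℂ V] (x y : V) : Prop :=
  ∃ z : ℂ, ‖z‖ = 1 ∧ ‖x + z • y‖ = ‖x‖ + ‖y‖

/-- A (right) Hilbert module over a C⋆-algebra `A`, not assumed unital. The right action of `a` on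
`x` is `x <• a`, and the `A`-valued inner product `inner A x y` is linear in its second variable.
The norm of `X` is the one given by the inner product, and `X` is complete for it.
(Mathlib's `CStarModule` has the left-module convention `inner A x (a • y) = a * inner A x y`
instead, and does not ask for completeness.) -/
class HilbertCStarModule (A X : Type*) [NonUnitalCStarAlgebra A] [NormedAddCommGroup X]
    [NormedSpace ℂ X] [SMul Aᵐᵒᵖ X] extends Inner A X, CompleteSpace X where
  add_rsmul (x y : X) (a : A) : (x + y) <• a = x <• a + y <• a
  rsmul_add (x : X) (a b : A) : x <• (a + b) = x <• a + x <• b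
  rsmul_mul (x : X) (a b : A) : x <• (a * b) = (x <• a) <• b
  smul_rsmul (c : ℂ) (x : X) (a : A) : (c • x) <• a = c • (x <• a)
  rsmul_smul (c : ℂ) (x : X) (a : A) : x <• (c • a) = c • (x <• a)
  inner_add_right (x y z : X) : inner x (y + z) = inner x y + inner x z
  inner_smul_right (c : ℂ) (x y : X) : inner x (c • y) = c • inner x y
  inner_rsmul_right (x y : X) (a : A) : inner x (y <• a) = inner x y * a
  star_inner (x y : X) : star (inner x y) = inner y x
  /-- `⟨x, x⟩` is a positive element of `A`. -/
  inner_self_positive (x : X) : ∃ b : A, inner x x = star b * b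
  inner_self_eq_zero (x : X) : inner x x = 0 ↔ x = 0
  norm_eq_sqrt_norm_inner_self (x : X) : ‖x‖ = √‖inner x x‖

/-- The spectral radius of an element of a possibly non-unital complex algebra: the supremum of
`|k|` over the spectrum of the element, taken in the unitization. (If the algebra already has a
unit, this adds at most the point `0` to the spectrum, so the radius is the usual one.) -/
noncomputable def nonUnitalSpectralRadius {A : Type*} [NonUnitalCStarAlgebra A] (a : A) : ℝ≥0∞ :=
  spectralRadius ℂ (a : Unitization ℂ A)

/-!
For unit vectors `x`, `y` put `c = ⟨x, y⟩`, viewed in the unitization. From `⟨x, x⟩, ⟨y, y⟩ ≤ 1` one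
gets `⟨x + y, x + y⟩ ≤ (1 + c)⋆ + (1 + c)`, hence `‖x + y‖² ≤ 2 ‖1 + c‖`; from `⟨x - y, x - y⟩ ≥ 0`
one gets `⟨x + y, x + y⟩ ≥ 2 (c⋆ + c)`, hence `2 ‖1 + c‖² ≤ 4 + ‖x + y‖²`. So `‖x + y‖ = 2` iff
`‖1 + c‖ = 2`, and `x ∥ y` iff `1 ∥ c` and `‖c‖ = 1`.

If `|k| = ‖a‖`, the parallelogram identity `(k - a)⋆(k - a) + (k + a)⋆(k + a) = 2 (|k|² + a⋆a)`
shows that `‖k + a‖ = 2 ‖a‖` forces `k ∈ σ(a)`. Hence `1 ∥ a` iff `r(a) = ‖a‖`.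

Conditions (i), (ii) and (iv) are equivalent for each fixed `λ`, by Cauchy–Schwarz and the triangle
inequality alone. Passing from `A` to `Aᵐᵒᵖ` turns right modules into left ones and preserves norms
and spectral radii.
-/

section Parallel

theorem norm_smul_add_smul_of_norm_add_eq {E : Type*} [SeminormedAddCommGroup E]
    [NormedSpace ℝ E] {x y : E}
    (h : ‖x + y‖ = ‖x‖ + ‖y‖) {s t : ℝ} (hs : 0 ≤ s) (ht : 0 ≤ t) :
    ‖s • x + t • y‖ = s * ‖x‖ + t * ‖y‖ := by
  wlog hts : t ≤ s generalizing x y s t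
  · rw [add_comm, this (by rw [add_comm, h, add_comm]) ht hs (le_of_not_ge hts), add_comm]
  refine le_antisymm ?_ ?_
  · simpa [norm_smul, abs_of_nonneg, hs, ht] using norm_add_le (s • x) (t • y)
  · have hsum : s • (x + y) = (s • x + t • y) + (s - t) • y := by module
    have htri := norm_add_le (s • x + t • y) ((s - t) • y)
    rw [← hsum, norm_smul, norm_smul, h, Real.norm_of_nonneg hs,
      Real.norm_of_nonneg (sub_nonneg.2 hts)] at htri
    linarith

variable {V : Type*} [NormedAddCommGroup V] [NormedSpace ℂ V] {x y : V}

theorem parallel_zero_left (y : V) : Parallel 0 y := ⟨1, by simp, by simp⟩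

theorem parallel_zero_right (x : V) : Parallel x 0 := ⟨1, by simp, by simp⟩

theorem parallel_iff_exists_norm_smul_add :
    Parallel x y ↔ ∃ z : ℂ, ‖z‖ = 1 ∧ ‖z • x + y‖ = ‖x‖ + ‖y‖ := by
  refine (Equiv.inv ℂ).exists_congr fun z => ?_
  rw [Equiv.inv_apply, norm_inv, inv_eq_one]
  refine and_congr_right fun hz => ?_
  have hz0 : z ≠ 0 := norm_ne_zero_iff.1 (by simp [hz])
  have hrotate : z⁻¹ • (x + z • y) = z⁻¹ • x + y := by rw [smul_add, inv_smul_smul₀ hz0]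
  rw [← hrotate, norm_smul, norm_inv, hz, inv_one, one_mul]

theorem Parallel.smul_smul (h : Parallel x y) {s t : ℝ} (hs : 0 ≤ s) (ht : 0 ≤ t) :
    Parallel (s • x) (t • y) := by
  obtain ⟨z, hz, hxy⟩ := h
  have hzy : ‖z • y‖ = ‖y‖ := by rw [norm_smul, hz, one_mul]
  refine ⟨z, hz, ?_⟩
  rw [smul_comm, norm_smul_add_smul_of_norm_add_eq (by rw [hxy, hzy]) hs ht, hzy, norm_smul,
    norm_smul, Real.norm_of_nonneg hs, Real.norm_of_nonneg ht]

theorem parallel_smul_smul_iff {s t : ℝ} (hs : 0 < s) (ht : 0 < t) :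
    Parallel (s • x) (t • y) ↔ Parallel x y := by
  refine ⟨fun h => ?_, fun h => h.smul_smul hs.le ht.le⟩
  simpa [hs.ne', ht.ne'] using h.smul_smul (inv_nonneg.2 hs.le) (inv_nonneg.2 ht.le)

end Parallel

section CStarAlgebra

attribute [local instance] CStarAlgebra.spectralOrder CStarAlgebra.spectralOrderedRing

variable {U : Type*}

theorem spectralRadius_eq_nnnorm_iff [NormedRing U] [NormedAlgebra ℂ U] [CompleteSpace U]
    [NormOneClass U] {a : U} :
    spectralRadius ℂ a = ‖a‖₊ ↔ ∃ k ∈ spectrum ℂ a, ‖k‖ = ‖a‖ := by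
  have : Nontrivial U := NormOneClass.nontrivial
  constructor
  · intro h
    obtain ⟨k, hk, hka⟩ := spectrum.exists_nnnorm_eq_spectralRadius a
    exact ⟨k, hk, congrArg NNReal.toReal (ENNReal.coe_injective (hka.trans h))⟩
  · rintro ⟨k, hk, hka⟩
    refine le_antisymm (spectrum.spectralRadius_le_nnnorm a) ?_
    rw [← show ‖k‖₊ = ‖a‖₊ from NNReal.eq hka]
    exact le_iSup₂ (α := ENNReal) k hk

variable [CStarAlgebra U] [Nontrivial U]

theorem not_isUnit_sub_of_norm_add_eq {a b : U} (hnorm : ‖a‖ = ‖b‖)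
    (hadd : ‖a + b‖ = ‖a‖ + ‖b‖) : ¬ IsUnit (a - b) := by
  intro hunit
  have star_mul_self_le (c : U) (hc : ‖c‖ = ‖b‖) :
      star c * c ≤ algebraMap ℝ U (‖b‖ ^ 2) := by
    rw [← CStarAlgebra.norm_le_iff_le_algebraMap _ (by positivity) (star_mul_self_nonneg c),
      CStarRing.norm_star_mul_self, hc, sq]
  have hparallelogram : star (a - b) * (a - b) + star (a + b) * (a + b)
      = (2 : ℝ) • (star a * a + star b * b) := by
    simp only [star_sub, star_add, two_smul]
    noncomm_ring
  have hle : star (a - b) * (a - b)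
      ≤ algebraMap ℝ U ‖star (a + b) * (a + b)‖ - star (a + b) * (a + b) := by
    rw [le_sub_iff_add_le, hparallelogram, CStarRing.norm_star_mul_self, hadd, hnorm,
      show (‖b‖ + ‖b‖) * (‖b‖ + ‖b‖) = 2 * (‖b‖ ^ 2 + ‖b‖ ^ 2) by ring, map_mul, map_add,
      ← Algebra.smul_def]
    gcongr
    exacts [star_mul_self_le a hnorm, star_mul_self_le b rfl]
  exact CStarAlgebra.norm_mem_spectrum_of_nonneg (star_mul_self_nonneg (a + b))
    (CStarAlgebra.isUnit_of_le _ hle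
      ((hunit.star.mul hunit).isStrictlyPositive (star_mul_self_nonneg _)))

theorem norm_algebraMap_add_eq_iff_mem_spectrum {a : U} {k : ℂ} (hk : ‖k‖ = ‖a‖) :
    ‖algebraMap ℂ U k + a‖ = ‖k‖ + ‖a‖ ↔ k ∈ spectrum ℂ a := by
  have hk' : ‖algebraMap ℂ U k‖ = ‖k‖ := norm_algebraMap' U k
  refine ⟨fun h => not_isUnit_sub_of_norm_add_eq (hk'.trans hk) (by rw [h, hk']), fun h => ?_⟩
  refine le_antisymm (hk' ▸ norm_add_le _ _) ?_
  have hmem : k + k ∈ spectrum ℂ (algebraMap ℂ U k + a) := by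
    rw [← spectrum.singleton_add_eq]
    exact Set.add_mem_add rfl h
  calc ‖k‖ + ‖a‖ = ‖k + k‖ := by rw [← hk, ← two_mul, ← two_mul, norm_mul]; norm_num
    _ ≤ ‖algebraMap ℂ U k + a‖ := spectrum.norm_le_norm_of_mem hmem

theorem parallel_one_iff_exists_mem_spectrum {a : U} :
    Parallel 1 a ↔ ∃ k ∈ spectrum ℂ a, ‖k‖ = ‖a‖ := by
  rcases eq_or_ne a 0 with rfl | ha
  · exact iff_of_true (parallel_zero_right 1) ⟨0, by simp, by simp⟩
  have ha' : 0 < ‖a‖ := norm_pos_iff.2 ha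
  have hnorm : ‖‖a‖ • (1 : U)‖ = ‖a‖ := by rw [norm_smul, norm_norm, norm_one, mul_one]
  have hsmul (z : ℂ) : z • ‖a‖ • (1 : U) = algebraMap ℂ U (z * ‖a‖) := by
    rw [Algebra.algebraMap_eq_smul_one, mul_smul, Complex.coe_smul]
  have hscale : Parallel 1 a ↔ Parallel (‖a‖ • (1 : U)) a := by
    rw [← parallel_smul_smul_iff ha' one_pos, one_smul]
  rw [hscale, parallel_iff_exists_norm_smul_add]
  simp only [hsmul, hnorm]
  constructor
  · rintro ⟨z, hz, h⟩
    have hza : ‖z * ‖a‖‖ = ‖a‖ := by simp [hz]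
    exact ⟨z * ‖a‖, (norm_algebraMap_add_eq_iff_mem_spectrum hza).1 (by rw [h, hza]), hza⟩
  · rintro ⟨k, hk, hka⟩
    have hcancel : k / ‖a‖ * ‖a‖ = k := div_mul_cancel₀ k (by exact_mod_cast ha'.ne')
    refine ⟨k / ‖a‖, by simp [hka, ha'.ne'], ?_⟩
    rw [hcancel, (norm_algebraMap_add_eq_iff_mem_spectrum hka).2 hk, hka]

end CStarAlgebra

theorem nonUnitalSpectralRadius_eq_ofReal_norm_iff {A : Type*} [NonUnitalCStarAlgebra A] {a : A} :
    nonUnitalSpectralRadius a = ENNReal.ofReal ‖a‖ ↔ Parallel 1 (a : Unitization ℂ A) := by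
  rw [parallel_one_iff_exists_mem_spectrum, ← spectralRadius_eq_nnnorm_iff, Unitization.nnnorm_inr,
    nonUnitalSpectralRadius, ofReal_norm, enorm_eq_nnnorm]

theorem isQuasiregular_op_iff {R : Type*} [NonUnitalSemiring R] {x : R} :
    IsQuasiregular (MulOpposite.op x) ↔ IsQuasiregular x := by
  simp only [isQuasiregular_iff, MulOpposite.exists, ← MulOpposite.op_mul,
    ← MulOpposite.op_add, MulOpposite.op_eq_zero_iff]
  refine exists_congr fun y => ?_
  rw [and_comm, add_comm x y]

theorem quasispectrum_op (R : Type*) {A : Type*} [CommSemiring R] [NonUnitalRing A] [Module R A]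
    (a : A) : quasispectrum R (MulOpposite.op a) = quasispectrum R a := by
  ext r
  simp only [quasispectrum, Set.mem_ofPred_eq, ← MulOpposite.op_smul, ← MulOpposite.op_neg,
    isQuasiregular_op_iff]

theorem nonUnitalSpectralRadius_op {A : Type*} [NonUnitalCStarAlgebra A] (a : A) :
    nonUnitalSpectralRadius (MulOpposite.op a) = nonUnitalSpectralRadius a := by
  simp only [nonUnitalSpectralRadius, spectralRadius, ← Unitization.quasispectrum_eq_spectrum_inr,
    quasispectrum_op]

section CStarModule

variable {A X : Type*} [NonUnitalCStarAlgebra A] [PartialOrder A] [StarOrderedRing A]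
  [NormedAddCommGroup X] [NormedSpace ℂ X] [SMul A X] [CStarModule A X] {x y : X}

theorem inr_inner_self_nonneg (x : X) : 0 ≤ (inner A x x : Unitization ℂ A) :=
  Unitization.inr_nonneg_iff.2 CStarModule.inner_self_nonneg

theorem inr_inner_self_le_one (hx : ‖x‖ ≤ 1) : (inner A x x : Unitization ℂ A) ≤ 1 := by
  rw [← CStarAlgebra.norm_le_one_iff_of_nonneg _ (inr_inner_self_nonneg x),
    Unitization.norm_inr, ← CStarModule.norm_sq_eq A]
  exact pow_le_one₀ (norm_nonneg x) hx

theorem sq_norm_add_le_two_mul_norm_one_add_inner (hx : ‖x‖ ≤ 1) (hy : ‖y‖ ≤ 1) :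
    ‖x + y‖ ^ 2 ≤ 2 * ‖(1 + inner A x y : Unitization ℂ A)‖ := by
  set c : Unitization ℂ A := ↑(inner A x y) with hc
  have hle : (inner A (x + y) (x + y) : Unitization ℂ A) ≤ star (1 + c) + (1 + c) := by
    have hexpand : (inner A (x + y) (x + y) : Unitization ℂ A)
        = inner A x x + inner A y y + (star c + c) := by
      simp only [CStarModule.inner_add_left, CStarModule.inner_add_right, Unitization.inr_add, hc,
        ← Unitization.inr_star, CStarModule.star_inner]
      abel
    calc _ ≤ 1 + 1 + (star c + c) := by
          rw [hexpand]
          gcongr <;> exact inr_inner_self_le_one ‹_›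
      _ = _ := by rw [star_add, star_one]; abel
  calc ‖x + y‖ ^ 2 = ‖(inner A (x + y) (x + y) : Unitization ℂ A)‖ := by
        rw [Unitization.norm_inr, ← CStarModule.norm_sq_eq A]
    _ ≤ ‖star (1 + c) + (1 + c)‖ :=
        CStarAlgebra.norm_le_norm_of_nonneg_of_le (inr_inner_self_nonneg _) hle
    _ ≤ 2 * ‖1 + c‖ := by
        simpa only [norm_star, two_mul] using norm_add_le (star (1 + c)) (1 + c)

theorem two_mul_sq_norm_one_add_inner_le (h : ‖inner A x y‖ ≤ 1) :
    2 * ‖(1 + inner A x y : Unitization ℂ A)‖ ^ 2 ≤ 4 + ‖x + y‖ ^ 2 := by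
  set c : Unitization ℂ A := ↑(inner A x y) with hc
  set p : Unitization ℂ A := ↑(inner A (x + y) (x + y)) with hp
  have hre : (2 : ℝ) • (star c + c) ≤ p := by
    have hpolar : p - (2 : ℝ) • (star c + c) = inner A (x - y) (x - y) := by
      simp only [hp, hc, CStarModule.inner_add_left, CStarModule.inner_add_right,
        CStarModule.inner_sub_left, CStarModule.inner_sub_right, Unitization.inr_add,
        Unitization.inr_sub, ← Unitization.inr_star, CStarModule.star_inner, two_smul]
      abel
    exact sub_nonneg.1 (hpolar ▸ inr_inner_self_nonneg (x - y))
  have hcc : star c * c ≤ 1 := by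
    rw [← CStarAlgebra.norm_le_one_iff_of_nonneg _ (star_mul_self_nonneg c),
      CStarRing.norm_star_mul_self, hc, Unitization.norm_inr]
    exact mul_le_one₀ h (norm_nonneg _) h
  have hle : (2 : ℝ) • (star (1 + c) * (1 + c)) ≤ (4 : ℝ) • 1 + p :=
    calc (2 : ℝ) • (star (1 + c) * (1 + c))
        = (2 : ℝ) • 1 + (2 : ℝ) • (star c * c) + (2 : ℝ) • (star c + c) := by
          simp only [star_add, star_one, two_smul]
          noncomm_ring
      _ ≤ (2 : ℝ) • 1 + (2 : ℝ) • 1 + p := by gcongr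
      _ = (4 : ℝ) • 1 + p := by rw [← add_smul]; norm_num
  calc 2 * ‖1 + c‖ ^ 2 = ‖(2 : ℝ) • (star (1 + c) * (1 + c))‖ := by
        rw [norm_smul, CStarRing.norm_star_mul_self, sq, Real.norm_ofNat]
    _ ≤ ‖(4 : ℝ) • 1 + p‖ :=
        CStarAlgebra.norm_le_norm_of_nonneg_of_le
          (smul_nonneg zero_le_two (star_mul_self_nonneg _)) hle
    _ ≤ ‖(4 : ℝ) • (1 : Unitization ℂ A)‖ + ‖p‖ := norm_add_le _ _
    _ = 4 + ‖x + y‖ ^ 2 := by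
        rw [norm_smul, norm_one, mul_one, Real.norm_ofNat, hp, Unitization.norm_inr,
          ← CStarModule.norm_sq_eq A]

theorem norm_add_eq_two_iff_norm_one_add_inner_eq_two (hx : ‖x‖ = 1) (hy : ‖y‖ = 1) :
    ‖x + y‖ = 2 ↔ ‖(1 + inner A x y : Unitization ℂ A)‖ = 2 := by
  have hinner : ‖inner A x y‖ ≤ 1 := by
    simpa only [hx, hy, mul_one] using CStarModule.norm_inner_le X (A := A) (x := x) (y := y)
  have hle := norm_add_le x y
  have hle' := norm_add_le (1 : Unitization ℂ A) (inner A x y)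
  rw [norm_one, Unitization.norm_inr] at hle'
  have h₁ := sq_norm_add_le_two_mul_norm_one_add_inner (A := A) hx.le hy.le
  have h₂ := two_mul_sq_norm_one_add_inner_le hinner
  constructor
  · intro h
    rw [h] at h₁
    linarith
  · intro h
    rw [h] at h₂
    nlinarith [norm_nonneg (x + y)]

theorem parallel_iff_of_norm_eq_one (hx : ‖x‖ = 1) (hy : ‖y‖ = 1) :
    Parallel x y ↔ Parallel 1 (inner A x y : Unitization ℂ A) ∧ ‖inner A x y‖ = 1 := by
  have hone_add (z : ℂ) (hz : ‖z‖ = 1) :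
      ‖x + z • y‖ = 2 ↔ ‖(1 + z • inner A x y : Unitization ℂ A)‖ = 2 := by
    have hzy : ‖z • y‖ = 1 := by rw [norm_smul, hz, hy, one_mul]
    rw [norm_add_eq_two_iff_norm_one_add_inner_eq_two (A := A) hx hzy,
      CStarModule.inner_smul_right_complex, Unitization.inr_smul]
  constructor
  · rintro ⟨z, hz, h⟩
    have h2 := (hone_add z hz).1 (by rw [h, hx, hy, one_add_one_eq_two])
    have htri := norm_add_le (1 : Unitization ℂ A) (z • (inner A x y : Unitization ℂ A))
    rw [h2, norm_one, norm_smul, hz, one_mul, Unitization.norm_inr] at htri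
    have hle := CStarModule.norm_inner_le X (A := A) (x := x) (y := y)
    rw [hx, hy] at hle
    have hnorm : ‖inner A x y‖ = 1 := by linarith
    refine ⟨⟨z, hz, ?_⟩, hnorm⟩
    rw [h2, norm_one, Unitization.norm_inr, hnorm, one_add_one_eq_two]
  · rintro ⟨⟨z, hz, h⟩, hnorm⟩
    rw [norm_one, Unitization.norm_inr, hnorm, one_add_one_eq_two] at h
    exact ⟨z, hz, by rw [(hone_add z hz).2 h, hx, hy, one_add_one_eq_two]⟩

theorem parallel_iff_parallel_one_inner :
    Parallel x y ↔
      Parallel 1 (inner A x y : Unitization ℂ A) ∧ ‖inner A x y‖ = ‖x‖ * ‖y‖ := by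
  by_cases h0 : x = 0 ∨ y = 0
  · have hxy : ‖x‖ * ‖y‖ = 0 := by simpa using h0
    have hinner : inner A x y = 0 := norm_le_zero_iff.1 (hxy ▸ CStarModule.norm_inner_le X)
    refine iff_of_true ?_ ?_
    · rcases h0 with rfl | rfl
      exacts [parallel_zero_left y, parallel_zero_right x]
    · simpa [hinner, hxy] using parallel_zero_right 1
  push Not at h0
  obtain ⟨hx, hy⟩ := h0
  have hs : 0 < ‖x‖ := norm_pos_iff.2 hx
  have ht : 0 < ‖y‖ := norm_pos_iff.2 hy
  set u := NormedSpace.normalize x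
  set v := NormedSpace.normalize y
  have hxu : ‖x‖ • u = x := NormedSpace.norm_smul_normalize x
  have hyv : ‖y‖ • v = y := NormedSpace.norm_smul_normalize y
  have hinner : inner A x y = (‖x‖ * ‖y‖) • inner A u v := by
    rw [mul_smul, ← CStarModule.inner_smul_right_real, ← CStarModule.inner_smul_left_real, hxu, hyv]
  calc Parallel x y ↔ Parallel u v := by
        rw [← parallel_smul_smul_iff (x := u) hs ht, hxu, hyv]
    _ ↔ Parallel 1 (inner A u v : Unitization ℂ A) ∧ ‖inner A u v‖ = 1 :=
        parallel_iff_of_norm_eq_one (NormedSpace.norm_normalize hx) (NormedSpace.norm_normalize hy)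
    _ ↔ _ := by
        rw [hinner, Unitization.inr_smul, norm_smul, Real.norm_of_nonneg (mul_pos hs ht).le,
          mul_eq_left₀ (mul_pos hs ht).ne', ← parallel_smul_smul_iff one_pos (mul_pos hs ht),
          one_smul]

theorem norm_inner_self_add_eq_iff_norm_add_eq :
    ‖inner A x (x + y)‖ = ‖x‖ * (‖x‖ + ‖y‖) ↔ ‖x + y‖ = ‖x‖ + ‖y‖ := by
  constructor
  · intro h
    rcases eq_or_ne x 0 with rfl | hx
    · simp
    refine le_antisymm (norm_add_le x y) (le_of_mul_le_mul_left ?_ (norm_pos_iff.2 hx))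
    exact h ▸ CStarModule.norm_inner_le X
  · intro h
    have hself := (CStarModule.norm_sq_eq A (x := x + y)).symm
    rw [CStarModule.inner_add_left] at hself
    have htri := norm_add_le (inner A x (x + y)) (inner A y (x + y))
    have hx := CStarModule.norm_inner_le X (A := A) (x := x) (y := x + y)
    have hy := CStarModule.norm_inner_le X (A := A) (x := y) (y := x + y)
    rw [h] at hself hx hy
    linarith

theorem norm_inner_self_add_eq_iff_norm_inner_add_inner_eq :
    ‖inner A x (x + y)‖ = ‖x‖ * (‖x‖ + ‖y‖) ↔
      ‖inner A x x + inner A x y‖ = ‖inner A x x‖ + ‖inner A x y‖ ∧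
        ‖inner A x y‖ = ‖x‖ * ‖y‖ := by
  rw [CStarModule.inner_add_right, ← CStarModule.norm_sq_eq A, mul_add, ← sq]
  constructor
  · intro h
    have htri := norm_add_le (inner A x x) (inner A x y)
    rw [h, ← CStarModule.norm_sq_eq A, add_le_add_iff_left] at htri
    have hnorm : ‖inner A x y‖ = ‖x‖ * ‖y‖ := le_antisymm (CStarModule.norm_inner_le X) htri
    exact ⟨by rw [h, hnorm], hnorm⟩
  · rintro ⟨h, hnorm⟩
    rw [h, hnorm]

end CStarModule

theorem mainTheorem6_general {A X : Type*} [NonUnitalCStarAlgebra A] [PartialOrder A]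
    [StarOrderedRing A] [NormedAddCommGroup X] [NormedSpace ℂ X] [SMul A X] [CStarModule A X]
    (x y : X) :
    List.TFAE [
      Parallel x y,
      Parallel (inner A x x) (inner A x y) ∧ ‖inner A x y‖ = ‖x‖ * ‖y‖,
      nonUnitalSpectralRadius (inner A x y) = ENNReal.ofReal ‖inner A x y‖ ∧
        ‖inner A x y‖ = ‖x‖ * ‖y‖,
      ∃ z : ℂ, ‖z‖ = 1 ∧ ‖inner A x (x + z • y)‖ = ‖x‖ * (‖x‖ + ‖y‖)] := by
  tfae_have 1 ↔ 3 := by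
    rw [parallel_iff_parallel_one_inner (A := A), nonUnitalSpectralRadius_eq_ofReal_norm_iff]
  tfae_have 4 ↔ 1 := exists_congr fun z => and_congr_right fun hz => by
    simpa only [norm_smul, hz, one_mul] using
      norm_inner_self_add_eq_iff_norm_add_eq (A := A) (x := x) (y := z • y)
  tfae_have 4 ↔ 2 := by
    rw [Parallel, ← exists_and_right]
    refine exists_congr fun z => ?_
    rw [and_assoc]
    refine and_congr_right fun hz => ?_
    simpa only [norm_smul, hz, one_mul, CStarModule.inner_smul_right_complex] using
      norm_inner_self_add_eq_iff_norm_inner_add_inner_eq (A := A) (x := x) (y := z • y)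
  tfae_finish

attribute [local instance] CStarAlgebra.spectralOrder CStarAlgebra.spectralOrderedRing

/-- A right Hilbert `A`-module as a Hilbert C⋆-module over `Aᵐᵒᵖ` in the sense of Mathlib, whose
inner product satisfies `inner B x (b • y) = b * inner B x y` for `B = Aᵐᵒᵖ`. -/
abbrev HilbertCStarModule.toCStarModuleMulOpposite (A X : Type*) [NonUnitalCStarAlgebra A]
    [NormedAddCommGroup X] [NormedSpace ℂ X] [SMul Aᵐᵒᵖ X] [HilbertCStarModule A X] :
    CStarModule Aᵐᵒᵖ X where
  inner x y := .op (inner A x y)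
  inner_add_right := by simp [HilbertCStarModule.inner_add_right]
  inner_self_nonneg {x} := by
    obtain ⟨b, hb⟩ := HilbertCStarModule.inner_self_positive (A := A) x
    rw [hb, MulOpposite.op_mul, MulOpposite.op_star]
    exact mul_star_self_nonneg _
  inner_self := by simp [HilbertCStarModule.inner_self_eq_zero]
  inner_op_smul_right {a x y} :=
    congrArg MulOpposite.op (HilbertCStarModule.inner_rsmul_right x y a.unop)
  inner_smul_right_complex := by simp [HilbertCStarModule.inner_smul_right]
  star_inner x y := congrArg MulOpposite.op (HilbertCStarModule.star_inner x y)
  norm_eq_sqrt_norm_inner_self x := HilbertCStarModule.norm_eq_sqrt_norm_inner_self x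

theorem mainTheorem6 {A X : Type*} [NonUnitalCStarAlgebra A] [NormedAddCommGroup X]
    [NormedSpace ℂ X] [SMul Aᵐᵒᵖ X] [HilbertCStarModule A X] (x y : X) :
    List.TFAE [
      Parallel x y,
      Parallel (inner A x x) (inner A x y) ∧ ‖inner A x y‖ = ‖x‖ * ‖y‖,
      nonUnitalSpectralRadius (inner A x y) = ENNReal.ofReal ‖inner A x y‖ ∧
        ‖inner A x y‖ = ‖x‖ * ‖y‖,
      ∃ z : ℂ, ‖z‖ = 1 ∧ ‖inner A x (x + z • y)‖ = ‖x‖ * (‖x‖ + ‖y‖)] := by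
  let _ := HilbertCStarModule.toCStarModuleMulOpposite A X
  exact nonUnitalSpectralRadius_op (inner A x y) ▸ mainTheorem6_general (A := Aᵐᵒᵖ) x y
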